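/- Let $u, v > 1$ be integers and let $e, f$ be rational numbers such that $eu$ and $fv$ are positive integers. Put $q = 1/(uv)$ and $(z;q)_n = \prod_{k=0}^{n-1}(1 - zq^k)$ (so $(z;q)_0 = 1$). Then the infinite continued fraction with partial quotients $eu, fv, eu^2, fv^2, eu^3, fv^3, \dots$ converges, both series below converge, the series in the denominator is non-zero, and $$[0;\overline{e u^{n}, f v^{n}}]_{n=1}^{\infty} = \frac{1}{eu} - \frac{1}{e^2 f u^2 v + e}\cdot \frac{\displaystyle\sum_{n=0}^{\infty} \frac{(ef)^{-n}(uv)^{-n(n+3)/2}}{(q;q)_n\,\bigl(-1/(e f u^3 v^2);q\bigr)_n}} {\displaystyle\sum_{n=0}^{\infty} \frac{(ef)^{-n}(uv)^{-n(n+1)/2}}{(q;q)_n\,\bigl(-1/(e f u^2 v);q\bigr)_n}} .$$ -/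

import Mathlib

open Filter Topology

noncomputable section

/-- The simple continued fraction `[h; b 0, b 1, b 2, …]`, i.e. `h + 1/(b 0 + 1/(b 1 + ⋯))`. -/
def simpleCF (h : ℝ) (b : ℕ → ℝ) : GenContFract ℝ :=
  ⟨h, Stream'.Seq.ofStream (fun n => ⟨1, b n⟩)⟩

/-- The interlaced sequence `x 1, y 1, x 2, y 2, x 3, y 3, …`, indexed from `0`. -/
def interlace (x y : ℕ → ℝ) (k : ℕ) : ℝ :=
  if Even k then x (k / 2 + 1) else y (k / 2 + 1)

/-- The finite `q`-product `(z; q)_n = ∏_{k=0}^{n-1} (1 - z q^k)`. -/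
def qProd (z q : ℝ) (n : ℕ) : ℝ :=
  ∏ k ∈ Finset.range n, (1 - z * q ^ k)

/-- The `n`-th term of the numerator series, with `q = 1/(uv)`:
`(ef)^{-n} (uv)^{-n(n+3)/2} / ((q; q)_n (-1/(e f u^3 v^2); q)_n)`.
The exponent `n(n+3)/2` is an exact division, since `n(n+3)` is even. -/
def numTerm (u v e f : ℝ) (n : ℕ) : ℝ :=
  (1 / (e * f)) ^ n * (1 / (u * v)) ^ (n * (n + 3) / 2) /
    (qProd (1 / (u * v)) (1 / (u * v)) n *
      qProd (-1 / (e * f * u ^ 3 * v ^ 2)) (1 / (u * v)) n)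

/-- The `n`-th term of the denominator series, with `q = 1/(uv)`:
`(ef)^{-n} (uv)^{-n(n+1)/2} / ((q; q)_n (-1/(e f u^2 v); q)_n)`.
The exponent `n(n+1)/2` is an exact division, since `n(n+1)` is even. -/
def denTerm (u v e f : ℝ) (n : ℕ) : ℝ :=
  (1 / (e * f)) ^ n * (1 / (u * v)) ^ (n * (n + 1) / 2) /
    (qProd (1 / (u * v)) (1 / (u * v)) n *
      qProd (-1 / (e * f * u ^ 2 * v)) (1 / (u * v)) n)

end

/-! ### Continued fractions with prescribed complete quotients -/

/-! The tails of the continued fraction can be written down explicitly. Put F(s, z) = ∑ sⁿ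
q^(n(n-1)/2) / ((q; q)ₙ (-z; q)ₙ). Two contiguous relations, `qSeries_sub` and
`one_add_mul_qSeries`, show that suitable ratios of values of F satisfy r k * (b k + r (k + 1)) = 1
(`geomTail_mul`). Positive solutions of this recurrence with b k ≥ 1 force the convergents to tend
to r 0 (`simpleCF_convs_tendsto`), and one more use of `qSeries_sub` gives r 0 the stated form. -/

theorem simpleCF_get? (h : ℝ) (b : ℕ → ℝ) (n : ℕ) :
    (simpleCF h b).s.get? n = some ⟨1, b n⟩ := rfl

theorem simpleCF_nums_add_two (h : ℝ) (b : ℕ → ℝ) (n : ℕ) :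
    (simpleCF h b).nums (n + 2) =
      b (n + 1) * (simpleCF h b).nums (n + 1) + (simpleCF h b).nums n := by
  simpa using GenContFract.nums_recurrence (simpleCF_get? h b (n + 1)) rfl rfl

theorem simpleCF_dens_add_two (h : ℝ) (b : ℕ → ℝ) (n : ℕ) :
    (simpleCF h b).dens (n + 2) =
      b (n + 1) * (simpleCF h b).dens (n + 1) + (simpleCF h b).dens n := by
  simpa using GenContFract.dens_recurrence (simpleCF_get? h b (n + 1)) rfl rfl

theorem simpleCF_nums_one (b : ℕ → ℝ) : (simpleCF 0 b).nums 1 = 1 := by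
  simpa [simpleCF] using GenContFract.first_num_eq (simpleCF_get? 0 b 0)

theorem simpleCF_dens_one (h : ℝ) (b : ℕ → ℝ) : (simpleCF h b).dens 1 = b 0 := by
  simpa using GenContFract.first_den_eq (simpleCF_get? h b 0)

theorem simpleCF_dens_ge (h : ℝ) {b : ℕ → ℝ} (hb : ∀ k, 1 ≤ b k) (n : ℕ) :
    1 ≤ (simpleCF h b).dens n ∧ (n : ℝ) + 1 ≤ (simpleCF h b).dens (n + 1) := by
  induction n with
  | zero => simpa [simpleCF_dens_one] using hb 0
  | succ n ih =>
    obtain ⟨h1, h2⟩ := ih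
    have hn : (0 : ℝ) ≤ n := n.cast_nonneg
    refine ⟨by linarith, ?_⟩
    rw [simpleCF_dens_add_two]
    push_cast
    nlinarith [hb (n + 1)]

/-- The error of a convergent in terms of the tails `r k = 1 / (b k + r (k + 1))`. -/
theorem simpleCF_tail_mul_dens_sub_nums {b r : ℕ → ℝ}
    (hr : ∀ k, r k * (b k + r (k + 1)) = 1) (n : ℕ) :
    r 0 * (simpleCF 0 b).dens n - (simpleCF 0 b).nums n =
      (-1) ^ n * ∏ i ∈ Finset.range (n + 1), r i := by
  induction n using Nat.twoStepInduction with
  | zero => simp [simpleCF]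
  | one =>
    rw [simpleCF_dens_one, simpleCF_nums_one]
    simp only [Finset.prod_range_succ, Finset.prod_range_zero]
    linear_combination hr 0
  | more n ih1 ih2 =>
    rw [simpleCF_dens_add_two, simpleCF_nums_add_two]
    rw [Finset.prod_range_succ] at ih2
    rw [Finset.prod_range_succ, Finset.prod_range_succ]
    simp only [pow_succ] at ih2 ⊢
    linear_combination b (n + 1) * ih2 + ih1 -
      (-1) ^ n * (∏ i ∈ Finset.range (n + 1), r i) * hr (n + 1)

/-- Every tail lies in (0, 1], so the error of a convergent is at most 1 / dens, and the
denominators grow at least linearly. -/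
theorem simpleCF_convs_tendsto {b r : ℕ → ℝ} (hb : ∀ k, 1 ≤ b k) (hpos : ∀ k, 0 < r k)
    (hr : ∀ k, r k * (b k + r (k + 1)) = 1) :
    Tendsto (simpleCF 0 b).convs atTop (𝓝 (r 0)) := by
  have hle : ∀ k, r k ≤ 1 := fun k => by
    nlinarith [hr k, hb k, hpos k, mul_pos (hpos k) (hpos (k + 1))]
  change Tendsto (fun n => (simpleCF 0 b).convs n) atTop _
  rw [← tendsto_add_atTop_iff_nat 1, tendsto_iff_dist_tendsto_zero]
  refine squeeze_zero (fun _ => dist_nonneg) (fun n => ?_) tendsto_one_div_add_atTop_nhds_zero_nat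
  have hd := (simpleCF_dens_ge 0 hb n).2
  have hn : (0 : ℝ) < n + 1 := n.cast_add_one_pos
  have hB : 0 < (simpleCF 0 b).dens (n + 1) := hn.trans_le hd
  have herr := simpleCF_tail_mul_dens_sub_nums hr (n + 1)
  have hprod : |∏ i ∈ Finset.range (n + 1 + 1), r i| ≤ 1 := by
    rw [Finset.abs_prod]
    exact Finset.prod_le_one (fun _ _ => abs_nonneg _)
      fun i _ => by rw [abs_of_pos (hpos i)]; exact hle i
  rw [GenContFract.conv_eq_num_div_den, dist_comm, Real.dist_eq]
  have : r 0 - (simpleCF 0 b).nums (n + 1) / (simpleCF 0 b).dens (n + 1) =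
      ((-1) ^ (n + 1) * ∏ i ∈ Finset.range (n + 1 + 1), r i) / (simpleCF 0 b).dens (n + 1) := by
    rw [← herr]; field_simp
  rw [this, abs_div, abs_mul, abs_pow, abs_neg, abs_one, one_pow, one_mul, abs_of_pos hB]
  exact div_le_div₀ zero_le_one hprod hn hd

/-! ### The basic hypergeometric series `∑ sⁿ q^(n(n-1)/2) / ((q; q)ₙ (-z; q)ₙ)` -/

theorem qProd_zero (z q : ℝ) : qProd z q 0 = 1 := by simp [qProd]

theorem qProd_succ (z q : ℝ) (n : ℕ) : qProd z q (n + 1) = qProd z q n * (1 - z * q ^ n) := by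
  simp [qProd, Finset.prod_range_succ]

theorem qProd_succ' (z q : ℝ) (n : ℕ) : qProd z q (n + 1) = (1 - z) * qProd (z * q) q n := by
  simp only [qProd, Finset.prod_range_succ', pow_zero, mul_one]
  rw [mul_comm]
  congr 1
  exact Finset.prod_congr rfl fun k _ => by ring

theorem qProd_self_pos {q : ℝ} (hq0 : 0 < q) (hq1 : q < 1) (n : ℕ) : 0 < qProd q q n :=
  Finset.prod_pos fun k _ => by
    have := pow_lt_one₀ hq0.le hq1 k.succ_ne_zero
    rw [pow_succ'] at this
    linarith

theorem qProd_neg_pos {q z : ℝ} (hq0 : 0 < q) (hz : 0 < z) (n : ℕ) : 0 < qProd (-z) q n :=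
  Finset.prod_pos fun k _ => by
    have := mul_pos hz (pow_pos hq0 k)
    linarith

/-- The `n`-th term `sⁿ q^(n(n-1)/2) / ((q; q)ₙ (-z; q)ₙ)`. -/
noncomputable def qTerm (q s z : ℝ) (n : ℕ) : ℝ :=
  s ^ n * q ^ n.choose 2 / (qProd q q n * qProd (-z) q n)

/-- The sum of the series with terms `qTerm q s z n`. -/
noncomputable def qSeries (q s z : ℝ) : ℝ := ∑' n, qTerm q s z n

section
variable {q s z : ℝ}

theorem qTerm_zero (q s z : ℝ) : qTerm q s z 0 = 1 := by simp [qTerm, qProd_zero]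

theorem qTerm_pos (hq0 : 0 < q) (hq1 : q < 1) (hs : 0 < s) (hz : 0 < z) (n : ℕ) :
    0 < qTerm q s z n := by
  have := qProd_self_pos hq0 hq1 n
  have := qProd_neg_pos hq0 hz n
  unfold qTerm
  positivity

theorem choose_succ_two (n : ℕ) : (n + 1).choose 2 = n.choose 2 + n := by
  rw [Nat.choose_succ_succ' n 1, Nat.choose_one_right, add_comm]

theorem qTerm_succ (hq0 : 0 < q) (hq1 : q < 1) (hz : 0 < z) (n : ℕ) :
    qTerm q s z (n + 1) =
      s * q ^ n / ((1 - q ^ (n + 1)) * (1 + z * q ^ n)) * qTerm q s z n := by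
  have h1 := (qProd_self_pos hq0 hq1 n).ne'
  have h2 := (qProd_neg_pos hq0 hz n).ne'
  have h3 : 1 - q ^ (n + 1) ≠ 0 := (sub_pos.2 (pow_lt_one₀ hq0.le hq1 n.succ_ne_zero)).ne'
  have h4 : 1 + z * q ^ n ≠ 0 := by positivity
  unfold qTerm
  rw [qProd_succ, qProd_succ, choose_succ_two, ← pow_succ', neg_mul, sub_neg_eq_add]
  field_simp
  ring

theorem summable_qTerm (hq0 : 0 < q) (hq1 : q < 1) (hs : 0 < s) (hz : 0 < z) :
    Summable (qTerm q s z) := by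
  refine summable_of_ratio_test_tendsto_lt_one zero_lt_one
    (.of_forall fun n => (qTerm_pos hq0 hq1 hs hz n).ne') ?_
  have hp : Tendsto (fun n : ℕ => q ^ n) atTop (𝓝 0) :=
    tendsto_pow_atTop_nhds_zero_of_lt_one hq0.le hq1
  have hlim : Tendsto (fun n : ℕ => s * q ^ n / ((1 - q ^ (n + 1)) * (1 + z * q ^ n)))
      atTop (𝓝 (s * 0 / ((1 - 0) * (1 + z * 0)))) :=
    (hp.const_mul s).div (((hp.comp (tendsto_add_atTop_nat 1)).const_sub 1).mul
      ((hp.const_mul z).const_add 1)) (by norm_num)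
  have := hlim.norm
  simp only [mul_zero, zero_div, norm_zero] at this
  refine this.congr fun n => ?_
  rw [qTerm_succ hq0 hq1 hz, norm_mul,
    mul_div_cancel_right₀ _ (norm_ne_zero_iff.2 (qTerm_pos hq0 hq1 hs hz n).ne')]

theorem qSeries_pos (hq0 : 0 < q) (hq1 : q < 1) (hs : 0 < s) (hz : 0 < z) :
    0 < qSeries q s z :=
  (summable_qTerm hq0 hq1 hs hz).tsum_pos (fun n => (qTerm_pos hq0 hq1 hs hz n).le) 0
    (qTerm_pos hq0 hq1 hs hz 0)

/-- Subtracting termwise gives a factor 1 - qⁿ, which kills the term n = 0 and cancels the last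
factor of (q; q)ₙ; then the index shifts by one. -/
theorem qSeries_sub (hq0 : 0 < q) (hq1 : q < 1) (hs : 0 < s) (hz : 0 < z) :
    qSeries q s z - qSeries q (s * q) z = s / (1 + z) * qSeries q (s * q) (z * q) := by
  have hS := summable_qTerm hq0 hq1 hs hz
  have hT := summable_qTerm hq0 hq1 (mul_pos hs hq0) hz
  unfold qSeries
  rw [← hS.tsum_sub hT, (hS.sub hT).tsum_eq_zero_add, ← tsum_mul_left]
  simp only [qTerm_zero, sub_self, zero_add]
  refine tsum_congr fun n => ?_
  have h1 := (qProd_self_pos hq0 hq1 n).ne'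
  have h2 := (qProd_neg_pos hq0 (mul_pos hz hq0) n).ne'
  have h3 : 1 - q ^ (n + 1) ≠ 0 := (sub_pos.2 (pow_lt_one₀ hq0.le hq1 n.succ_ne_zero)).ne'
  have h4 : 1 + z ≠ 0 := by positivity
  unfold qTerm
  rw [qProd_succ, qProd_succ', choose_succ_two, ← pow_succ', neg_mul, sub_neg_eq_add]
  field_simp
  ring

/-- Holds term by term: the right side collects a factor 1 + z qⁿ, and (1 + z)(-zq; q)ₙ = (-z; q)ₙ
(1 + z qⁿ). -/
theorem one_add_mul_qSeries (hq0 : 0 < q) (hq1 : q < 1) (hs : 0 < s) (hz : 0 < z) :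
    (1 + z) * qSeries q s z = qSeries q s (z * q) + z * qSeries q (s * q) (z * q) := by
  have hzq := mul_pos hz hq0
  have hS := summable_qTerm hq0 hq1 hs hzq
  have hT := (summable_qTerm hq0 hq1 (mul_pos hs hq0) hzq).mul_left z
  unfold qSeries
  rw [← tsum_mul_left, ← tsum_mul_left, ← hS.tsum_add hT]
  refine tsum_congr fun n => ?_
  have h1 := (qProd_self_pos hq0 hq1 n).ne'
  have h2 := (qProd_neg_pos hq0 hz n).ne'
  have h3 := (qProd_neg_pos hq0 hzq n).ne'
  have h : (1 + z) * qProd (-(z * q)) q n = qProd (-z) q n * (1 + z * q ^ n) := by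
    have := (qProd_succ' (-z) q n).symm.trans (qProd_succ (-z) q n)
    simpa only [neg_mul, sub_neg_eq_add] using this
  unfold qTerm
  field_simp
  linear_combination s ^ n * h

end

/-! ### The interlaced geometric continued fraction -/

section
variable {u v e f : ℝ}

/-- The tails of `[0; e u, f v, e u², f v², …]`, with `q = 1 / (u v)`: the argument
`s = q / (e f)` of the series is scaled by `q` after every two steps, and so is
`z = q / (e f u)`. -/
noncomputable def geomTail (u v e f : ℝ) : ℕ → ℝ :=
  fun k =>
    let q := 1 / (u * v)
    let s := q / (e * f) * q ^ (k / 2)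
    let z := q / (e * f * u) * q ^ (k / 2)
    if Even k then qSeries q (s * q) z / (e * u ^ (k / 2 + 1) * qSeries q s z)
    else e * u ^ (k / 2 + 1) * (s / (1 + z) * qSeries q (s * q) (z * q)) / qSeries q (s * q) z

theorem geomTail_pos (hu : 1 < u) (hv : 1 < v) (he : 0 < e) (hf : 0 < f) (k : ℕ) :
    0 < geomTail u v e f k := by
  have hu0 : 0 < u := zero_lt_one.trans hu
  have hv0 : 0 < v := zero_lt_one.trans hv
  have hq1 : 1 / (u * v) < 1 := (div_lt_one (by positivity)).2 (one_lt_mul_of_lt_of_le hu hv.le)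
  have hpos : ∀ {s z : ℝ}, 0 < s → 0 < z → 0 < qSeries (1 / (u * v)) s z :=
    fun hs hz => qSeries_pos (by positivity) hq1 hs hz
  dsimp only [geomTail]
  split_ifs
  · exact div_pos (hpos (by positivity) (by positivity))
      (mul_pos (by positivity) (hpos (by positivity) (by positivity)))
  · exact div_pos (mul_pos (by positivity) (mul_pos (by positivity)
      (hpos (by positivity) (by positivity)))) (hpos (by positivity) (by positivity))

theorem geomTail_mul (hu : 1 < u) (hv : 1 < v) (he : 0 < e) (hf : 0 < f) (k : ℕ) :
    geomTail u v e f k *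
      (interlace (fun n => e * u ^ n) (fun n => f * v ^ n) k + geomTail u v e f (k + 1)) = 1 := by
  have hu0 : 0 < u := zero_lt_one.trans hu
  have hv0 : 0 < v := zero_lt_one.trans hv
  have hq0 : 0 < 1 / (u * v) := by positivity
  have hq1 : 1 / (u * v) < 1 := (div_lt_one (by positivity)).2 (one_lt_mul_of_lt_of_le hu hv.le)
  have hq : 1 / (u * v) * (u * v) = 1 := by field_simp
  obtain ⟨j, rfl | rfl⟩ := k.even_or_odd'
  · have h1 : ¬ Even (2 * j + 1) := by simp
    have h2 : (2 * j + 1) / 2 = j := by omega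
    have h3 : 2 * j / 2 = j := by omega
    simp only [geomTail, interlace, if_neg h1, if_pos (even_two_mul j), h2, h3]
    generalize 1 / (u * v) = q at *
    have hs : 0 < q / (e * f) * q ^ j := by positivity
    have hz : 0 < q / (e * f * u) * q ^ j := by positivity
    generalize q / (e * f) * q ^ j = s at *
    generalize q / (e * f * u) * q ^ j = z at *
    -- With A = F(s, z), B = F(sq, z) and x = e u^(j+1), the claim is now B / (xA) * (x + x(A - B) /
    -- B) = 1.
    rw [← qSeries_sub hq0 hq1 hs hz]
    have hA := (qSeries_pos hq0 hq1 hs hz).ne'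
    have hB := (qSeries_pos hq0 hq1 (mul_pos hs hq0) hz).ne'
    field_simp
    ring
  · have h1 : ¬ Even (2 * j + 1) := by simp
    have h1' : Even (2 * j + 1 + 1) := ⟨j + 1, by ring⟩
    have h2 : (2 * j + 1) / 2 = j := by omega
    have h3 : (2 * j + 1 + 1) / 2 = j + 1 := by omega
    simp only [geomTail, interlace, if_neg h1, if_pos h1', h2, h3, pow_succ _ j, ← mul_assoc]
    have hqj : (1 / (u * v)) ^ j * (u ^ j * v ^ j) = 1 := by
      rw [← mul_pow, ← mul_pow, hq, one_pow]
    have hs : 0 < 1 / (u * v) / (e * f) * (1 / (u * v)) ^ j := by positivity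
    have hz : 0 < 1 / (u * v) / (e * f * u) * (1 / (u * v)) ^ j := by positivity
    -- In terms of s and z: zu = s, and s is the reciprocal of the product of the two partial
    -- quotients of index j + 1. These reduce the odd case to the second relation at (sq, z).
    have hsz : 1 / (u * v) / (e * f * u) * (1 / (u * v)) ^ j * u =
        1 / (u * v) / (e * f) * (1 / (u * v)) ^ j := by field_simp
    have hsf : 1 / (u * v) / (e * f) * (1 / (u * v)) ^ j * (e * u ^ j * u * (f * v ^ j * v)) =
        1 := by
      have hef : e * f / (e * f) = 1 := div_self (by positivity)
      generalize 1 / (u * v) = q at *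
      linear_combination q ^ j * (u ^ j * v ^ j) * (e * f / (e * f)) * hq +
        (e * f / (e * f)) * hqj + hef
    rw [pow_succ u (j + 1), pow_succ u j]
    generalize 1 / (u * v) / (e * f * u) * (1 / (u * v)) ^ j = z at *
    generalize 1 / (u * v) / (e * f) * (1 / (u * v)) ^ j = s at *
    generalize 1 / (u * v) = q at *
    have hrec := one_add_mul_qSeries hq0 hq1 (mul_pos hs hq0) hz
    have hA := (qSeries_pos hq0 hq1 (mul_pos hs hq0) hz).ne'
    have hB := (qSeries_pos hq0 hq1 (mul_pos hs hq0) (mul_pos hz hq0)).ne'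
    have h4 : 1 + z ≠ 0 := by positivity
    generalize qSeries q (s * q) z = A at *
    generalize qSeries q (s * q) (z * q) = B at *
    generalize qSeries q (s * q * q) (z * q) = C at *
    field_simp
    linear_combination u * B * hsf - u * hrec - C * hsz

theorem geomTail_zero (hu : 1 < u) (hv : 1 < v) (he : 0 < e) (hf : 0 < f) :
    geomTail u v e f 0 = 1 / (e * u) - 1 / (e ^ 2 * f * u ^ 2 * v + e) *
      (qSeries (1 / (u * v)) (1 / (u * v) / (e * f) * (1 / (u * v)))
          (1 / (u * v) / (e * f * u) * (1 / (u * v))) /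
        qSeries (1 / (u * v)) (1 / (u * v) / (e * f)) (1 / (u * v) / (e * f * u))) := by
  have hu0 : 0 < u := zero_lt_one.trans hu
  have hv0 : 0 < v := zero_lt_one.trans hv
  have hq0 : 0 < 1 / (u * v) := by positivity
  have hq1 : 1 / (u * v) < 1 := (div_lt_one (by positivity)).2 (one_lt_mul_of_lt_of_le hu hv.le)
  have hs : 0 < 1 / (u * v) / (e * f) := by positivity
  have hz : 0 < 1 / (u * v) / (e * f * u) := by positivity
  have hsub := qSeries_sub hq0 hq1 hs hz
  have hA := (qSeries_pos hq0 hq1 hs hz).ne'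
  have hc : 1 / (e ^ 2 * f * u ^ 2 * v + e) =
      1 / (u * v) / (e * f) / (1 + 1 / (u * v) / (e * f * u)) / (e * u) := by
    field_simp
  simp only [geomTail, Even.zero, if_true, Nat.zero_div, pow_zero, mul_one, zero_add, pow_one]
  -- Writes F(sq, z) as F(s, z) - (F(s, z) - F(sq, z)); the first part yields 1 / (eu), the second
  -- the quotient of series.
  rw [hc, ← sub_sub_cancel (qSeries _ (1 / (u * v) / (e * f)) _)
    (qSeries _ (1 / (u * v) / (e * f) * (1 / (u * v))) (1 / (u * v) / (e * f * u))), hsub]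
  generalize 1 / (u * v) / (e * f) / (1 + 1 / (u * v) / (e * f * u)) = t at *
  generalize qSeries _ (1 / (u * v) / (e * f)) _ = A at *
  generalize qSeries _ _ _ = B at *
  field_simp

theorem denTerm_eq_qTerm (u v e f : ℝ) :
    denTerm u v e f = qTerm (1 / (u * v)) (1 / (u * v) / (e * f)) (1 / (u * v) / (e * f * u)) := by
  funext n
  have h : n * (n + 1) / 2 = n + n.choose 2 := by
    rw [add_comm n (n.choose 2), ← choose_succ_two, Nat.choose_two_right, Nat.add_sub_cancel,
      mul_comm]
  have hz : -1 / (e * f * u ^ 2 * v) = -(1 / (u * v) / (e * f * u)) := by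
    rw [div_div, neg_div]; ring_nf
  rw [denTerm, qTerm, h, hz, pow_add, div_eq_mul_one_div _ (e * f), mul_pow]
  ring_nf

theorem numTerm_eq_qTerm (u v e f : ℝ) :
    numTerm u v e f = qTerm (1 / (u * v)) (1 / (u * v) / (e * f) * (1 / (u * v)))
      (1 / (u * v) / (e * f * u) * (1 / (u * v))) := by
  funext n
  have h : n * (n + 3) / 2 = n + n + n.choose 2 := by
    -- Uses (n + 2)(n + 1) = n(n + 3) + 2 to evaluate the halved exponent.
    have : (n + 2).choose 2 = n.choose 2 + n + (n + 1) := by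
      rw [choose_succ_two, choose_succ_two]
    rw [Nat.choose_two_right, show (n + 2) * (n + 2 - 1) = n * (n + 3) + 1 * 2 by
      rw [Nat.add_sub_assoc (by norm_num)]; ring, Nat.add_mul_div_right _ _ two_pos] at this
    omega
  have hz : -1 / (e * f * u ^ 3 * v ^ 2) = -(1 / (u * v) / (e * f * u) * (1 / (u * v))) := by
    rw [div_div, div_mul_div_comm, neg_div]; ring_nf
  rw [numTerm, qTerm, h, hz, pow_add, pow_add, div_eq_mul_one_div _ (e * f), mul_pow, mul_pow]
  ring_nf

theorem one_le_interlace {x y : ℕ → ℝ} (hx : ∀ n, 1 ≤ x (n + 1)) (hy : ∀ n, 1 ≤ y (n + 1))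
    (k : ℕ) : 1 ≤ interlace x y k := by
  unfold interlace
  split_ifs
  exacts [hx _, hy _]

end

/-- The only use of integrality: it makes every partial quotient at least 1. -/
theorem pos_and_one_le_mul_pow {u : ℕ} (hu : 1 < u) {e : ℚ}
    (he : ∃ a : ℕ, 0 < a ∧ e * (u : ℚ) = (a : ℚ)) :
    (0 : ℝ) < e ∧ ∀ n : ℕ, (1 : ℝ) ≤ e * (u : ℝ) ^ (n + 1) := by
  obtain ⟨a, ha, h⟩ := he
  have h' : (e : ℝ) * u = a := by exact_mod_cast h
  have ha' : (1 : ℝ) ≤ a := by exact_mod_cast ha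
  have hu' : (1 : ℝ) < u := by exact_mod_cast hu
  refine ⟨pos_of_mul_pos_left (by rw [h']; linarith) (by linarith), fun n => ?_⟩
  rw [pow_succ', ← mul_assoc, h']
  exact one_le_mul_of_one_le_of_one_le ha' (one_le_pow₀ hu'.le)

theorem theorem3 (u v : ℕ) (hu : 1 < u) (hv : 1 < v) (e f : ℚ)
    (he : ∃ a : ℕ, 0 < a ∧ e * (u : ℚ) = (a : ℚ))
    (hf : ∃ b : ℕ, 0 < b ∧ f * (v : ℚ) = (b : ℚ)) :
    Summable (numTerm u v e f) ∧ Summable (denTerm u v e f) ∧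
      (∑' n, denTerm u v e f n) ≠ 0 ∧
      Tendsto
        (simpleCF 0 (interlace (fun n => (e : ℝ) * (u : ℝ) ^ n)
          (fun n => (f : ℝ) * (v : ℝ) ^ n))).convs
        atTop
        (𝓝 (1 / ((e : ℝ) * u) -
          1 / ((e : ℝ) ^ 2 * f * (u : ℝ) ^ 2 * v + e) *
            ((∑' n, numTerm u v e f n) / (∑' n, denTerm u v e f n)))) := by
  obtain ⟨he0, hx⟩ := pos_and_one_le_mul_pow hu he
  obtain ⟨hf0, hy⟩ := pos_and_one_le_mul_pow hv hf
  have hu1 : (1 : ℝ) < u := by exact_mod_cast hu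
  have hv1 : (1 : ℝ) < v := by exact_mod_cast hv
  have hu0 : (0 : ℝ) < u := zero_lt_one.trans hu1
  have hv0 : (0 : ℝ) < v := zero_lt_one.trans hv1
  have hq0 : 0 < 1 / ((u : ℝ) * v) := by positivity
  have hq1 : 1 / ((u : ℝ) * v) < 1 :=
    (div_lt_one (by positivity)).2 (one_lt_mul_of_lt_of_le hu1 hv1.le)
  rw [numTerm_eq_qTerm, denTerm_eq_qTerm]
  refine ⟨summable_qTerm hq0 hq1 (by positivity) (by positivity),
    summable_qTerm hq0 hq1 (by positivity) (by positivity),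
    (qSeries_pos hq0 hq1 (by positivity) (by positivity)).ne', ?_⟩
  have := simpleCF_convs_tendsto (one_le_interlace hx hy) (geomTail_pos hu1 hv1 he0 hf0)
    (geomTail_mul hu1 hv1 he0 hf0)
  rwa [geomTail_zero hu1 hv1 he0 hf0] at this
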